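/- **Theorem ($\mathcal Q$-Lebesgue Differentiation Theorem).** Let $d\ge 1$, and let $\varphi\in C_c^\infty(B_1)$, $B_1\subset\mathbb R^d$ the open unit ball, satisfy $\varphi\ge 0$ and $\int\varphi\,dx=1$; put $\varphi_\varepsilon(x)=\varepsilon^{-d}\varphi(x/\varepsilon)$. Let $-\infty\le S<T\le\infty$ and $1\le p,q\le\infty$. Let $u:(S,T)\times\mathbb R^d\to\mathbb R^d$ be a vector field with $u\in L^1_{\mathrm{loc}}(S,T;\dot W^{1,p}(\mathbb R^d))$, meaning: $u$ is locally integrable on $(S,T)\times\mathbb R^d$, for a.e. $t$ the field $u(t,\cdot)$ has a weak gradient $\nabla u(t,\cdot)$, $\nabla u$ is measurable on $(S,T)\times\mathbb R^d$, and $\int_K\|\nabla u(t)\|_{L^p(\mathbb R^d)}\,dt<\infty$ for every compact $K\subset(S,T)$. Assume that 1. $\operatorname{div}u(t,\cdot)=0$ in the sense of distributions for a.e. $t\in(S,T)$, and 2. $\mathcal M(|\nabla u|)\in L^q((S,T)\times\mathbb R^d)$, where $\mathcal M(|\nabla u|)(t,x)=\sup_{r>0}\frac1{|B_r|}\int_{B_r(x)}|\nabla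 u(t,y)|\,dy$ is the spatial Hardy--Littlewood maximal function. For $\varepsilon>0$ let $u_\varepsilon(t,x)=\int_{\mathbb R^d}u(t,x-y)\varphi_\varepsilon(y)\,dy$ for $t\in(S,T)$ and $u_\varepsilon(t,x)=0$ for other $t$. Let $s\mapsto X_\varepsilon(t,x;s)$ be the solution of $\dot X_\varepsilon(t,x;s)=u_\varepsilon(s,X_\varepsilon(t,x;s))$, $X_\varepsilon(t,x;t)=x$, in the integrated (Carath\'eodory) sense; it is set equal to $x$ at times $s$ that no solution reaches. (Such times do not occur for $|s-t|<\varepsilon^2$ when $t\ne S,T$ and $\varepsilon$ is small enough, depending only on $t$.) Define the skewed cylinder $$Q_\varepsilon(t,x)=\{(s,y)\in\mathbb R\times\mathbb R^d:\ |s-t|<\varepsilon^2,\ |y-X_\varepsilon(t,x;s)|<\varepsilon\}.$$ Then for every $f\in L^1(\mathbb R\times\mathbb R^d)$, almost every $(t,x)\in\mathbb R\times\mathbb R^d$ is a $\mathcal Q$-Lebesgue point of $f$, that is, $$\lim_{\varepsilon\to0^+}\frac1{|Q_\varepsilon(t,x)|}\int_{Q_\varepsilon(t,x)}|f(s,y)-f(t,x)|\,ds\,dy=0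 .$$ -/

import Mathlib

open MeasureTheory Set Filter Topology
open scoped ENNReal ContDiff

namespace SkewedCylinder

/-- `ℝ^d` with the Euclidean norm. -/
abbrev Rd (d : ℕ) := EuclideanSpace ℝ (Fin d)

/-- The open interval `(S, T)` of real times, where `S`, `T` may be infinite. -/
def timeInterval (S T : EReal) : Set ℝ := {t : ℝ | S < (t : EReal) ∧ (t : EReal) < T}

/-- The space-time slab `(S, T) × ℝ^d`. -/
def slab (d : ℕ) (S T : EReal) : Set (ℝ × Rd d) := timeInterval S T ×ˢ (univ : Set (Rd d))

/-- A mollifier profile: `φ ∈ C_c^∞(B_1)`, `φ ≥ 0`, `∫ φ = 1`. -/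
structure IsMollifier {d : ℕ} (φ : Rd d → ℝ) : Prop where
  smooth : ContDiff ℝ ∞ φ
  tsupport_subset : tsupport φ ⊆ Metric.ball 0 1
  nonneg : ∀ x, 0 ≤ φ x
  integral_eq_one : ∫ x, φ x = 1

/-- The rescaled mollifier `φ_ε = ε^{-d} φ(· / ε)`. -/
noncomputable def scaledMollifier {d : ℕ} (φ : Rd d → ℝ) (ε : ℝ) (x : Rd d) : ℝ :=
  (ε ^ d)⁻¹ * φ (ε⁻¹ • x)

/-- `A` is the weak gradient of the vector field `v` on `ℝ^d`: both are locally integrable and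
`∫ (∂_e ψ) v = - ∫ ψ (A e)` for all test functions `ψ` and all directions `e`. -/
structure IsWeakGradient {d : ℕ} (v : Rd d → Rd d) (A : Rd d → (Rd d →L[ℝ] Rd d)) : Prop where
  locallyIntegrable : LocallyIntegrable v volume
  locallyIntegrable_grad : LocallyIntegrable A volume
  integral_eq : ∀ ψ : Rd d → ℝ, ContDiff ℝ ∞ ψ → HasCompactSupport ψ → ∀ e : Rd d,
    ∫ x, (fderiv ℝ ψ x e) • v x = - ∫ x, ψ x • (A x e)

/-- The vector field `v` on `ℝ^d` is divergence free in the sense of distributions. -/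
def IsWeaklyDivFree {d : ℕ} (v : Rd d → Rd d) : Prop :=
  ∀ ψ : Rd d → ℝ, ContDiff ℝ ∞ ψ → HasCompactSupport ψ → ∫ x, fderiv ℝ ψ x (v x) = 0

/-- `u ∈ L^1_loc(S, T; Ẇ^{1,p}(ℝ^d))` with spatial gradient `∇u = G`: the field `u` is locally
integrable on `(S, T) × ℝ^d`, for a.e. `t` the weak gradient of `u(t, ·)` is `G(t, ·)`, and
`t ↦ ‖G(t, ·)‖_{L^p}` is integrable on compact subsets of `(S, T)`. -/
structure MemL1LocHomSobolev {d : ℕ} (S T : EReal) (p : ℝ≥0∞) (u : ℝ → Rd d → Rd d)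
    (G : ℝ → Rd d → (Rd d →L[ℝ] Rd d)) : Prop where
  locallyIntegrableOn : LocallyIntegrableOn (Function.uncurry u) (slab d S T) volume
  aestronglyMeasurable_grad :
    AEStronglyMeasurable (Function.uncurry G) (volume.restrict (slab d S T))
  weakGradient : ∀ᵐ t ∂(volume.restrict (timeInterval S T)), IsWeakGradient (u t) (G t)
  lintegral_lt_top : ∀ K : Set ℝ, IsCompact K → K ⊆ timeInterval S T →
    ∫⁻ t in K, eLpNorm (G t) p volume < ⊤

/-- The (centred) spatial Hardy-Littlewood maximal function of `|g|`, with values in `[0, ∞]`. -/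
noncomputable def maximalFunction {d : ℕ} {F : Type*} [NormedAddCommGroup F]
    (g : Rd d → F) (x : Rd d) : ℝ≥0∞ :=
  ⨆ (r : ℝ) (_ : 0 < r), (volume (Metric.ball x r))⁻¹ * ∫⁻ y in Metric.ball x r, ‖g y‖ₑ

open Classical in
/-- The spatially mollified velocity `u_ε(t, ·) = u(t, ·) * φ_ε` for `t ∈ (S, T)`, extended by zero
to the other times. -/
noncomputable def mollifiedVelocity {d : ℕ} (φ : Rd d → ℝ) (S T : EReal) (u : ℝ → Rd d → Rd d)
    (ε t : ℝ) (x : Rd d) : Rd d :=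
  if t ∈ timeInterval S T then ∫ y, scaledMollifier φ ε y • u t (x - y) else 0

/-- `Y` solves `Ẏ(r) = v(r, Y(r))`, `Y(t) = x` for times `r` between `t` and `s`. As `v` is only
integrable in time, the equation holds in the sense of Carathéodory, that is, in integrated form. -/
structure IsTrajectory {d : ℕ} (v : ℝ → Rd d → Rd d) (t : ℝ) (x : Rd d) (s : ℝ) (Y : ℝ → Rd d) :
    Prop where
  continuousOn : ContinuousOn Y (uIcc t s)
  intervalIntegrable : IntervalIntegrable (fun r => v r (Y r)) volume t s
  eq_integral : ∀ r ∈ uIcc t s, Y r = x + ∫ τ in t..r, v τ (Y τ)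

open Classical in
/-- The flow of `v`: the value at time `s` of the trajectory that is at `x` at time `t`. (The value
`x` is assigned when no trajectory reaches time `s`.) -/
noncomputable def flow {d : ℕ} (v : ℝ → Rd d → Rd d) (t : ℝ) (x : Rd d) (s : ℝ) : Rd d :=
  if h : ∃ Y, IsTrajectory v t x s Y then h.choose s else x

/-- The mollified flow `X_ε(t, x; s)`. -/
noncomputable def mollifiedFlow {d : ℕ} (φ : Rd d → ℝ) (S T : EReal) (u : ℝ → Rd d → Rd d)
    (ε t : ℝ) (x : Rd d) (s : ℝ) : Rd d :=
  flow (mollifiedVelocity φ S T u ε) t x s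

/-- The skewed parabolic cylinder
`Q_ε(t, x) = {(s, y) : |s - t| < ε², |y - X_ε(t, x; s)| < ε}`. -/
def skewedCylinder {d : ℕ} (φ : Rd d → ℝ) (S T : EReal) (u : ℝ → Rd d → Rd d)
    (ε t : ℝ) (x : Rd d) : Set (ℝ × Rd d) :=
  {z | |z.1 - t| < ε ^ 2 ∧ ‖z.2 - mollifiedFlow φ S T u ε t x z.1‖ < ε}

/-- `(t, x)` is a `𝒬`-Lebesgue point of `f`: the average of `|f(s, y) - f(t, x)|` over `Q_ε(t, x)`
tends to `0` as `ε → 0+`. -/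
def IsQLebesguePoint {d : ℕ} (φ : Rd d → ℝ) (S T : EReal) (u : ℝ → Rd d → Rd d)
    (f : ℝ × Rd d → ℝ) (t : ℝ) (x : Rd d) : Prop :=
  Tendsto (fun ε : ℝ => ⨍ z in skewedCylinder φ S T u ε t x, |f z - f (t, x)|) (𝓝[>] 0) (𝓝 0)

end SkewedCylinder

/-! The cylinder `Q_ε` is skewed only at a scale that vanishes relative to `ε`. On `B_ε(x)` the
velocity `u_ε(s, ·)` is at most `C ε^{-d} ∫_{B_{2ε}(x)} |u(s, ·)|`. At almost every point, the
integral of `|u|` over a parabolic cylinder of radius `r` is `O(r^{d+2})`, by Lebesgue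
differentiation. Hence during times `|s - t| < ε²` the flow moves by `O(ε^{-d} ε^{d+2}) = O(ε²)`,
eventually less than `ε / 2` (`ae_eventually_norm_mollifiedFlow_sub_lt`).

So `Q_ε(t, x)` lies between the parabolic cylinders of radii `ε / 4` and `2ε`, whose volumes have
the fixed ratio `8^{d+2}`. Differentiation along parabolic cylinders
(`ae_tendsto_average_parabolicCylinder`) then passes to `Q_ε` (`isQLebesguePoint_of_tendsto`). -/

namespace SkewedCylinder

/-! ### Parabolic metric and Lebesgue differentiation -/

/-- The closed parabolic cylinder with centre `z` and radius `r`. -/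
def parabolicCylinder {d : ℕ} (z : ℝ × Rd d) (r : ℝ) : Set (ℝ × Rd d) :=
  Metric.closedBall z.1 (r ^ 2) ×ˢ Metric.closedBall z.2 r

theorem volume_parabolicCylinder {d : ℕ} (z : ℝ × Rd d) {r : ℝ} (hr : 0 ≤ r) :
    volume (parabolicCylinder z r) =
      ENNReal.ofReal (r ^ (d + 2)) * (2 * volume (Metric.ball (0 : Rd d) 1)) := by
  rw [parabolicCylinder, Measure.volume_eq_prod, Measure.prod_prod, Real.volume_closedBall,
    Measure.addHaar_closedBall _ _ hr, finrank_euclideanSpace_fin, pow_add,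
    ENNReal.ofReal_mul (by positivity), ENNReal.ofReal_mul (by positivity), ENNReal.ofReal_ofNat]
  ring

/-- The real line with the metric `|s - t| ^ (1 / 2)`. -/
abbrev ParabolicTime := Metric.Snowflaking ℝ (1 / 2) (by norm_num) (by norm_num)

noncomputable instance : MeasurableSpace ParabolicTime := borel _

instance : BorelSpace ParabolicTime := ⟨rfl⟩

/-- Space-time with its parabolic metric is homeomorphic to space-time. -/
noncomputable def parabolicHomeomorph (d : ℕ) : ParabolicTime × Rd d ≃ₜ ℝ × Rd d :=
  Metric.Snowflaking.homeomorph.prodCongr (Homeomorph.refl _)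

theorem preimage_closedBall_parabolicHomeomorph_symm {d : ℕ} (w : ParabolicTime × Rd d) {r : ℝ}
    (hr : 0 ≤ r) :
    (parabolicHomeomorph d).symm ⁻¹' Metric.closedBall w r =
      parabolicCylinder (parabolicHomeomorph d w) r := by
  rcases w with ⟨t, x⟩
  have hball : Metric.closedBall t r = Metric.closedBall t ((r ^ 2) ^ (1 / 2 : ℝ)) := by
    rw [← Real.sqrt_eq_rpow, Real.sqrt_sq hr]
  rw [← closedBall_prod_same, hball]
  ext ⟨s, y⟩
  refine and_congr_left fun _ => ?_
  change dist _ _ ≤ _ ↔ dist _ _ ≤ _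
  rw [show dist ((parabolicHomeomorph d).symm (s, y)).1 t =
    dist s (Metric.Snowflaking.ofSnowflaking t) ^ (1 / 2 : ℝ) from rfl]
  exact Real.rpow_le_rpow_iff dist_nonneg (by positivity) (by norm_num)

/-- Lebesgue measure on space-time with its parabolic metric. -/
noncomputable def parabolicVolume (d : ℕ) : Measure (ParabolicTime × Rd d) :=
  Measure.map (parabolicHomeomorph d).symm volume

theorem measurePreserving_parabolicHomeomorph_symm (d : ℕ) :
    MeasurePreserving (parabolicHomeomorph d).symm volume (parabolicVolume d) :=
  (parabolicHomeomorph d).symm.measurable.measurePreserving _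

theorem parabolicVolume_closedBall {d : ℕ} (w : ParabolicTime × Rd d) {r : ℝ} (hr : 0 ≤ r) :
    parabolicVolume d (Metric.closedBall w r) =
      ENNReal.ofReal (r ^ (d + 2)) * (2 * volume (Metric.ball (0 : Rd d) 1)) := by
  rw [parabolicVolume, Measure.map_apply (parabolicHomeomorph d).symm.measurable
    measurableSet_closedBall, preimage_closedBall_parabolicHomeomorph_symm w hr,
    volume_parabolicCylinder _ hr]

theorem two_mul_volume_ball_ne_top (d : ℕ) : 2 * volume (Metric.ball (0 : Rd d) 1) ≠ ⊤ :=
  ENNReal.mul_ne_top (by simp) measure_ball_lt_top.ne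

theorem two_mul_volume_ball_ne_zero (d : ℕ) : 2 * volume (Metric.ball (0 : Rd d) 1) ≠ 0 :=
  mul_ne_zero (by simp) (Metric.measure_ball_pos _ _ one_pos).ne'

instance (d : ℕ) : IsLocallyFiniteMeasure (parabolicVolume d) where
  finiteAtNhds w := ⟨Metric.closedBall w 1, Metric.closedBall_mem_nhds w one_pos, by
    rw [parabolicVolume_closedBall w zero_le_one]
    exact ENNReal.mul_lt_top ENNReal.ofReal_lt_top (two_mul_volume_ball_ne_top d).lt_top⟩

/-- Balls have volume proportional to `r ^ (d + 2)`, so doubling holds with factor `2 ^ (d + 2)`.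
This makes differentiation along parabolic balls available. -/
instance (d : ℕ) : IsUnifLocDoublingMeasure (parabolicVolume d) where
  exists_measure_closedBall_le_mul'' := by
    refine ⟨2 ^ (d + 2), ?_⟩
    filter_upwards [self_mem_nhdsWithin] with r (hr : 0 < r) w
    rw [parabolicVolume_closedBall w (by positivity), parabolicVolume_closedBall w hr.le, mul_pow,
      ENNReal.ofReal_mul (by positivity), ENNReal.ofReal_pow (by norm_num), ENNReal.ofReal_ofNat,
      mul_assoc]
    norm_cast

/-- This is differentiation for doubling measures, transported along a measure-preserving
homeomorphism under which closed balls become parabolic cylinders. -/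
theorem ae_tendsto_average_parabolicCylinder {d : ℕ} {E : Type*} [NormedAddCommGroup E]
    {f : ℝ × Rd d → E} (hf : LocallyIntegrable f volume) :
    ∀ᵐ z : ℝ × Rd d, Tendsto (fun r : ℝ => ⨍ w in parabolicCylinder z r, ‖f w - f z‖)
      (𝓝[>] 0) (𝓝 0) := by
  have hmp := measurePreserving_parabolicHomeomorph_symm d
  have hemb := (parabolicHomeomorph d).symm.measurableEmbedding
  have hloc : LocallyIntegrable (f ∘ parabolicHomeomorph d) (parabolicVolume d) := by
    intro w
    obtain ⟨s, hs, hfs⟩ := hf (parabolicHomeomorph d w)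
    refine ⟨parabolicHomeomorph d ⁻¹' s, (parabolicHomeomorph d).continuous.continuousAt hs, ?_⟩
    rw [← hmp.integrableOn_comp_preimage hemb]
    simpa [Function.comp_def, ← preimage_comp] using hfs
  filter_upwards [hmp.quasiMeasurePreserving.ae
    (IsUnifLocDoublingMeasure.ae_tendsto_average_norm_sub (parabolicVolume d) hloc 1)] with z hz
  refine (hz (l := 𝓝[>] (0 : ℝ)) (fun _ => (parabolicHomeomorph d).symm z) id tendsto_id
    ?_).congr' ?_
  · filter_upwards [self_mem_nhdsWithin] with r (hr : 0 < r)
    exact Metric.mem_closedBall_self (by simpa using hr.le)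
  · filter_upwards [self_mem_nhdsWithin] with r (hr : 0 < r)
    have hpre := preimage_closedBall_parabolicHomeomorph_symm
      ((parabolicHomeomorph d).symm z) hr.le
    rw [Homeomorph.apply_symm_apply] at hpre
    rw [setAverage_eq, setAverage_eq, measureReal_def, measureReal_def, id, ← hpre,
      hmp.measure_preimage measurableSet_closedBall.nullMeasurableSet,
      ← hmp.setIntegral_preimage_emb hemb]
    simp

/-! ### Mass of a locally integrable field on small parabolic cylinders -/

theorem measurableSet_parabolicCylinder {d : ℕ} (z : ℝ × Rd d) (r : ℝ) :
    MeasurableSet (parabolicCylinder z r) :=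
  measurableSet_closedBall.prod measurableSet_closedBall

theorem isCompact_parabolicCylinder {d : ℕ} (z : ℝ × Rd d) (r : ℝ) :
    IsCompact (parabolicCylinder z r) :=
  (isCompact_closedBall _ _).prod (isCompact_closedBall _ _)

theorem eventually_parabolicCylinder_subset {d : ℕ} {z : ℝ × Rd d} {V : Set (ℝ × Rd d)}
    (hV : V ∈ 𝓝 z) : ∀ᶠ r in 𝓝[>] (0 : ℝ), parabolicCylinder z r ⊆ V := by
  obtain ⟨ρ, hρ, hsub⟩ := Metric.nhds_basis_closedBall.mem_iff.1 hV
  filter_upwards [Ioc_mem_nhdsGT (lt_min hρ one_pos)] with r hr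
  -- For `r ≤ 1` the time radius `r ^ 2` is at most `r`.
  have h1 : r ≤ 1 := hr.2.trans (min_le_right _ _)
  have hrρ : r ≤ ρ := hr.2.trans (min_le_left _ _)
  refine Subset.trans ?_ hsub
  rw [← closedBall_prod_same]
  exact prod_mono (Metric.closedBall_subset_closedBall (by nlinarith [hr.1]))
    (Metric.closedBall_subset_closedBall hrρ)

/-- At a Lebesgue point the mean of `‖F‖` is eventually at most `1 + ‖F z‖`. As `F` need not be
integrable up to the boundary of `W`, it is first cut off to countably many open pieces covering
`W`. -/
theorem ae_exists_lintegral_parabolicCylinder_le {d : ℕ} {E : Type*} [NormedAddCommGroup E]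
    {F : ℝ × Rd d → E} {W : Set (ℝ × Rd d)} (hW : IsOpen W)
    (hF : LocallyIntegrableOn F W volume) :
    ∀ᵐ z : ℝ × Rd d, z ∈ W → ∃ A : ℝ, 0 ≤ A ∧ ∀ᶠ r in 𝓝[>] (0 : ℝ),
      ∫⁻ w in parabolicCylinder z r, ‖F w‖ₑ ≤ ENNReal.ofReal (A * r ^ (d + 2)) := by
  obtain ⟨V, hVo, hWV, hVi⟩ := hF.exists_nat_integrableOn
  have hint : ∀ n, Integrable ((V n ∩ W).indicator F) := fun n =>
    (integrable_indicator_iff ((hVo n).inter hW).measurableSet).2 (hVi n)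
  filter_upwards [ae_all_iff.2 fun n =>
    ae_tendsto_average_parabolicCylinder (hint n).locallyIntegrable] with z hz hzW
  obtain ⟨n, hn⟩ := mem_iUnion.1 (hWV hzW)
  set g := (V n ∩ W).indicator F with hg
  set κ := (2 * volume (Metric.ball (0 : Rd d) 1)).toReal with hκ
  refine ⟨κ * (1 + ‖g z‖), by positivity, ?_⟩
  filter_upwards [self_mem_nhdsWithin, (hz n).eventually_lt_const one_pos,
    eventually_parabolicCylinder_subset (((hVo n).inter hW).mem_nhds ⟨hn, hzW⟩)]
    with r (hr : 0 < r) havg hsub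
  have hvol : volume.real (parabolicCylinder z r) = r ^ (d + 2) * κ := by
    rw [measureReal_def, volume_parabolicCylinder z hr.le, ENNReal.toReal_mul,
      ENNReal.toReal_ofReal (by positivity)]
  have hκ0 : 0 < κ :=
    ENNReal.toReal_pos (two_mul_volume_ball_ne_zero d) (two_mul_volume_ball_ne_top d)
  have hgi : IntegrableOn g (parabolicCylinder z r) := (hint n).integrableOn
  have hci : IntegrableOn (fun _ => g z) (parabolicCylinder z r) :=
    integrableOn_const (isCompact_parabolicCylinder z r).measure_lt_top.ne
  have hle : ∫ w in parabolicCylinder z r, ‖g w‖ ≤ κ * (1 + ‖g z‖) * r ^ (d + 2) := by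
    calc ∫ w in parabolicCylinder z r, ‖g w‖
        ≤ ∫ w in parabolicCylinder z r, (‖g w - g z‖ + ‖g z‖) := by
          refine integral_mono hgi.norm ((hgi.sub hci).norm.add hci.norm) fun w => ?_
          simpa using norm_add_le (g w - g z) (g z)
      _ = (∫ w in parabolicCylinder z r, ‖g w - g z‖) + r ^ (d + 2) * κ * ‖g z‖ := by
          rw [integral_add (f := fun w => ‖g w - g z‖) (hgi.sub hci).norm hci.norm, setIntegral_const,
            hvol, smul_eq_mul]
      _ ≤ r ^ (d + 2) * κ + r ^ (d + 2) * κ * ‖g z‖ := by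
          rw [setAverage_eq, hvol, smul_eq_mul, inv_mul_lt_iff₀ (by positivity), mul_one] at havg
          gcongr
      _ = _ := by ring
  calc ∫⁻ w in parabolicCylinder z r, ‖F w‖ₑ = ∫⁻ w in parabolicCylinder z r, ‖g w‖ₑ :=
        setLIntegral_congr_fun (measurableSet_parabolicCylinder z r) fun w hw => by
          simp only [hg, indicator_of_mem (hsub hw)]
    _ = ENNReal.ofReal (∫ w in parabolicCylinder z r, ‖g w‖) :=
        (ofReal_integral_norm_eq_lintegral_enorm hgi).symm
    _ ≤ _ := ENNReal.ofReal_le_ofReal hle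

/-! ### Displacement of trajectories -/

theorem IsTrajectory.norm_sub_lt {d : ℕ} {v : ℝ → Rd d → Rd d} {t s : ℝ} {x : Rd d}
    {Y : ℝ → Rd d} (hY : IsTrajectory v t x s Y) {δ : ℝ} {g : ℝ → ℝ≥0∞}
    (hv : ∀ r ∈ uIcc t s, ∀ y, ‖y - x‖ ≤ δ → ‖v r y‖ₑ ≤ g r)
    (hg : ∫⁻ r in uIcc t s, g r < ENNReal.ofReal δ) : ‖Y s - x‖ < δ := by
  by_contra! hcon
  have hcont : ContinuousOn (fun r => ‖Y r - x‖) (uIcc t s) :=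
    (hY.continuousOn.sub continuousOn_const).norm
  have hcpt : IsCompact (uIcc t s ∩ (fun r => ‖Y r - x‖) ⁻¹' Ici δ) :=
    isCompact_uIcc.of_isClosed_subset (hcont.preimage_isClosed_of_isClosed isClosed_Icc
      isClosed_Ici) inter_subset_left
  -- Exit-time argument: `b` is the time nearest to `t` at which `Y` is at distance at least `δ`
  -- from `x`. Up to then the bound on `v` applies, so a displacement of `δ` costs at least `δ` in
  -- `∫ g`.
  obtain ⟨b, ⟨hb, hbδ⟩, hmin⟩ := hcpt.exists_isMinOn ⟨s, right_mem_uIcc, hcon⟩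
    (f := fun r => |r - t|) (by fun_prop)
  have hsub : uIcc t b ⊆ uIcc t s := uIcc_subset_uIcc_left hb
  have hlt : ∀ r ∈ uIoo t b, ‖Y r - x‖ ≤ δ := by
    intro r hr
    by_contra! hr'
    have hrb : |r - t| < |b - t| := by
      rcases le_total t b with h | h
      · rw [uIoo_of_le h] at hr
        rw [abs_of_nonneg (by linarith [hr.1]), abs_of_nonneg (by linarith)]
        linarith [hr.2]
      · rw [uIoo_of_ge h] at hr
        rw [abs_of_nonpos (by linarith [hr.2]), abs_of_nonpos (by linarith)]
        linarith [hr.1]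
    exact absurd (hmin ⟨hsub (Ioo_subset_Icc_self hr), hr'.le⟩) (not_le.2 hrb)
  have hbd : ENNReal.ofReal δ ≤ ∫⁻ r in uIcc t s, g r := by
    calc ENNReal.ofReal δ ≤ ENNReal.ofReal ‖Y b - x‖ := ENNReal.ofReal_le_ofReal hbδ
      _ = ‖∫ τ in uIoc t b, v τ (Y τ)‖ₑ := by
          rw [hY.eq_integral b hb, add_sub_cancel_left, intervalIntegral.norm_intervalIntegral_eq,
            ofReal_norm]
      _ ≤ ∫⁻ τ in uIoc t b, ‖v τ (Y τ)‖ₑ := enorm_integral_le_lintegral_enorm _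
      -- The endpoint `b` is a null set; it is dropped because only `δ ≤ ‖Y b - x‖` is known there.
      _ = ∫⁻ τ in uIoo t b, ‖v τ (Y τ)‖ₑ := setLIntegral_congr Ioo_ae_eq_Ioc.symm
      _ ≤ ∫⁻ τ in uIoo t b, g τ := setLIntegral_mono' measurableSet_Ioo fun τ hτ =>
          hv τ (hsub (Ioo_subset_Icc_self hτ)) _ (hlt τ hτ)
      _ ≤ ∫⁻ τ in uIcc t s, g τ := lintegral_mono_set
          (Subset.trans Ioo_subset_Icc_self hsub)
  exact absurd hg (not_lt.2 hbd)

/-- The previous bound holds for every trajectory, hence for the chosen one, and the default value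
`x` has displacement zero. Neither existence nor uniqueness is needed. -/
theorem norm_flow_sub_lt {d : ℕ} {v : ℝ → Rd d → Rd d} {t s : ℝ} {x : Rd d} {δ : ℝ} (hδ : 0 < δ)
    {g : ℝ → ℝ≥0∞} (hv : ∀ r ∈ uIcc t s, ∀ y, ‖y - x‖ ≤ δ → ‖v r y‖ₑ ≤ g r)
    (hg : ∫⁻ r in uIcc t s, g r < ENNReal.ofReal δ) : ‖flow v t x s - x‖ < δ := by
  unfold flow
  split_ifs with h
  · exact h.choose_spec.norm_sub_lt hv hg
  · simpa using hδ

/-! ### Pointwise bounds on the mollified velocity -/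

theorem IsMollifier.exists_scaledMollifier_le {d : ℕ} {φ : Rd d → ℝ} (hφ : IsMollifier φ) :
    ∃ C : ℝ, 0 ≤ C ∧ ∀ ε : ℝ, 0 < ε → ∀ y,
      |scaledMollifier φ ε y| ≤ (Metric.closedBall 0 ε).indicator (fun _ => C * (ε ^ d)⁻¹) y := by
  have hsupp : HasCompactSupport φ := HasCompactSupport.of_support_subset_isCompact
    (isCompact_closedBall 0 1) ((subset_tsupport φ).trans
      (hφ.tsupport_subset.trans Metric.ball_subset_closedBall))
  obtain ⟨C, hC⟩ := hsupp.exists_bound_of_continuous hφ.smooth.continuous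
  refine ⟨C, (norm_nonneg _).trans (hC 0), fun ε hε y => ?_⟩
  rw [scaledMollifier, abs_mul, abs_of_pos (by positivity : 0 < (ε ^ d)⁻¹)]
  by_cases hy : y ∈ Metric.closedBall (0 : Rd d) ε
  · rw [indicator_of_mem hy, mul_comm]
    exact mul_le_mul_of_nonneg_right (hC _) (by positivity)
  · have h0 : φ (ε⁻¹ • y) = 0 := by
      by_contra hne
      have hmem := hφ.tsupport_subset (subset_tsupport φ hne)
      rw [mem_ball_zero_iff, norm_smul, norm_inv, Real.norm_of_nonneg hε.le,
        inv_mul_lt_iff₀ hε, mul_one] at hmem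
      exact hy (mem_closedBall_zero_iff.2 hmem.le)
    rw [indicator_of_notMem hy, h0, abs_zero, mul_zero]

/-- The kernel has height of order `ε^{-d}` and support in the ball of radius `ε`; with `‖y - x‖ ≤
ε`, only points within `2ε` of `x` contribute. The bound is uniform in `y`, as the exit-time
argument requires. -/
theorem enorm_mollifiedVelocity_le {d : ℕ} {φ : Rd d → ℝ} {C ε : ℝ}
    (hC : ∀ y, |scaledMollifier φ ε y| ≤
      (Metric.closedBall 0 ε).indicator (fun _ => C * (ε ^ d)⁻¹) y)
    (S T : EReal) (u : ℝ → Rd d → Rd d) (t : ℝ) {x y : Rd d} (hy : ‖y - x‖ ≤ ε) :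
    ‖mollifiedVelocity φ S T u ε t y‖ₑ ≤ ENNReal.ofReal (C * (ε ^ d)⁻¹) *
      ∫⁻ w in Metric.closedBall x (2 * ε), ‖(slab d S T).indicator (Function.uncurry u) (t, w)‖ₑ := by
  unfold mollifiedVelocity
  split_ifs with ht
  · have hind : ∀ w, (slab d S T).indicator (Function.uncurry u) (t, w) = u t w := fun w =>
      indicator_of_mem (show (t, w) ∈ slab d S T from ⟨ht, mem_univ _⟩) _
    simp only [hind]
    calc ‖∫ z, scaledMollifier φ ε z • u t (y - z)‖ₑ
        ≤ ∫⁻ z, ‖scaledMollifier φ ε z • u t (y - z)‖ₑ := enorm_integral_le_lintegral_enorm _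
      _ = ∫⁻ w, ‖scaledMollifier φ ε (y - w) • u t w‖ₑ := by
          rw [← lintegral_sub_left_eq_self _ y]
          simp
      _ ≤ ∫⁻ w, (Metric.closedBall x (2 * ε)).indicator
            (fun w => ENNReal.ofReal (C * (ε ^ d)⁻¹) * ‖u t w‖ₑ) w := by
          refine lintegral_mono fun w => ?_
          rw [enorm_smul, Real.enorm_eq_ofReal_abs]
          have hw := hC (y - w)
          by_cases hyw : y - w ∈ Metric.closedBall (0 : Rd d) ε
          · rw [indicator_of_mem hyw] at hw
            have hmem : w ∈ Metric.closedBall x (2 * ε) := by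
              rw [mem_closedBall_zero_iff] at hyw
              rw [mem_closedBall_iff_norm]
              calc ‖w - x‖ = ‖(y - x) - (y - w)‖ := by rw [sub_sub_sub_cancel_left]
                _ ≤ ‖y - x‖ + ‖y - w‖ := norm_sub_le _ _
                _ ≤ 2 * ε := by linarith
            rw [indicator_of_mem hmem]
            gcongr
          · rw [indicator_of_notMem hyw] at hw
            rw [le_antisymm hw (abs_nonneg _)]
            simp
      _ = _ := by
          rw [lintegral_indicator measurableSet_closedBall,
            lintegral_const_mul' _ _ ENNReal.ofReal_ne_top]
  · simp

/-! ### Smallness of the mollified flow's displacement -/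

theorem isOpen_timeInterval (S T : EReal) : IsOpen (timeInterval S T) :=
  isOpen_Ioo.preimage continuous_coe_real_ereal

theorem isOpen_slab (d : ℕ) (S T : EReal) : IsOpen (slab d S T) :=
  (isOpen_timeInterval S T).prod isOpen_univ

theorem ae_fst_ne {d : ℕ} (a : ℝ) : ∀ᵐ z : ℝ × Rd d, z.1 ≠ a :=
  Measure.quasiMeasurePreserving_fst.ae (Measure.ae_ne volume a)

/-- The `L^1` norm over parabolic cylinders of a locally integrable field on a slab, extended by
zero, is controlled by the volume of the cylinder. -/
theorem ae_exists_lintegral_indicator_slab_le {d : ℕ} {E : Type*} [NormedAddCommGroup E]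
    {S T : EReal} {F : ℝ × Rd d → E} (hF : LocallyIntegrableOn F (slab d S T) volume) :
    ∀ᵐ z : ℝ × Rd d, ∃ A : ℝ, 0 ≤ A ∧ ∀ᶠ r in 𝓝[>] (0 : ℝ),
      ∫⁻ w in parabolicCylinder z r, ‖(slab d S T).indicator F w‖ₑ ≤
        ENNReal.ofReal (A * r ^ (d + 2)) := by
  -- Off the closed slab the extended field vanishes nearby, and the finite endpoint times are null.
  -- For an infinite endpoint `toReal` is `0`, which discards one more null time slice.
  filter_upwards [ae_exists_lintegral_parabolicCylinder_le (isOpen_slab d S T) hF,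
    ae_fst_ne S.toReal, ae_fst_ne T.toReal] with z hz hS hT
  by_cases hzs : z ∈ slab d S T
  · obtain ⟨A, hA, h⟩ := hz hzs
    refine ⟨A, hA, h.mono fun r hr => le_trans (lintegral_mono fun w => ?_) hr⟩
    exact enorm_indicator_le_enorm_self _ _
  · refine ⟨0, le_rfl, ?_⟩
    have hopen : IsOpen {w : ℝ × Rd d | (w.1 : EReal) < S ∨ T < (w.1 : EReal)} := by
      have hc : Continuous fun w : ℝ × Rd d => (w.1 : EReal) :=
        continuous_coe_real_ereal.comp continuous_fst
      exact (isOpen_lt hc continuous_const).union (isOpen_lt continuous_const hc)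
    have hmem : (z.1 : EReal) < S ∨ T < (z.1 : EReal) := by
      by_contra! hcon
      refine hzs ⟨⟨lt_of_le_of_ne hcon.1 fun h => hS ?_, lt_of_le_of_ne hcon.2 fun h => hT ?_⟩,
        mem_univ _⟩
      · rw [h, EReal.toReal_coe]
      · rw [← h, EReal.toReal_coe]
    filter_upwards [eventually_parabolicCylinder_subset (hopen.mem_nhds hmem)] with r hr
    rw [setLIntegral_congr_fun (measurableSet_parabolicCylinder z r) (g := fun _ => 0)
      fun w hw => ?_]
    · simp
    · have hw' : w ∉ slab d S T := fun h => (hr hw).elim (not_lt.2 h.1.1.le) (not_lt.2 h.1.2.le)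
      simp [indicator_of_notMem hw']

/-- At almost every point the mollified flow moves by less than `ε / 2` during times `ε ^ 2`. -/
theorem ae_eventually_norm_mollifiedFlow_sub_lt {d : ℕ} {φ : Rd d → ℝ} (hφ : IsMollifier φ)
    {S T : EReal} {u : ℝ → Rd d → Rd d}
    (hu : LocallyIntegrableOn (Function.uncurry u) (slab d S T) volume) :
    ∀ᵐ z : ℝ × Rd d, ∀ᶠ ε in 𝓝[>] (0 : ℝ), ∀ s, |s - z.1| < ε ^ 2 →
      ‖mollifiedFlow φ S T u ε z.1 z.2 s - z.2‖ < ε / 2 := by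
  obtain ⟨C, hC0, hC⟩ := hφ.exists_scaledMollifier_le
  have hmeas : AEMeasurable
      (fun w => ‖(slab d S T).indicator (Function.uncurry u) w‖ₑ) volume :=
    ((aestronglyMeasurable_indicator_iff (isOpen_slab d S T).measurableSet).2
      hu.aestronglyMeasurable).enorm
  filter_upwards [ae_exists_lintegral_indicator_slab_le hu] with z ⟨A, hA, hz⟩
  -- The displacement will be bounded by `C ε^{-d} · A (2ε)^{d+2} = C A 2^{d+2} ε²`; this condition
  -- makes it less than `ε / 2`.
  have hsmall : ∀ᶠ ε in 𝓝[>] (0 : ℝ), C * A * 2 ^ (d + 2) * ε < 1 / 2 := by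
    have : Tendsto (fun ε : ℝ => C * A * 2 ^ (d + 2) * ε) (𝓝[>] 0) (𝓝 0) := by
      refine Tendsto.mono_left ?_ nhdsWithin_le_nhds
      exact (by fun_prop : Continuous fun ε : ℝ => C * A * 2 ^ (d + 2) * ε).tendsto' _ _ (by simp)
    exact this.eventually_lt_const (by norm_num)
  filter_upwards [self_mem_nhdsWithin, hsmall,
    eventually_nhdsGT_zero_mul_left (two_pos : 0 < (2 : ℝ)) hz] with ε (hε : 0 < ε) hε' hint s hs
  refine norm_flow_sub_lt (half_pos hε) (fun r _ y hy =>
    enorm_mollifiedVelocity_le (hC ε hε) S T u r (hy.trans (half_le_self hε.le))) ?_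
  have hsub : uIcc z.1 s ⊆ Metric.closedBall z.1 ((2 * ε) ^ 2) := by
    intro r hr
    rw [Metric.mem_closedBall, Real.dist_eq]
    have := abs_sub_left_of_mem_uIcc hr
    nlinarith
  calc _ ≤ ∫⁻ r in Metric.closedBall z.1 ((2 * ε) ^ 2), ENNReal.ofReal (C * (ε ^ d)⁻¹) *
          ∫⁻ w in Metric.closedBall z.2 (2 * ε),
            ‖(slab d S T).indicator (Function.uncurry u) (r, w)‖ₑ := lintegral_mono_set hsub
    _ = ENNReal.ofReal (C * (ε ^ d)⁻¹) * ∫⁻ w in parabolicCylinder z (2 * ε),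
          ‖(slab d S T).indicator (Function.uncurry u) w‖ₑ := by
        rw [lintegral_const_mul' _ _ ENNReal.ofReal_ne_top, parabolicCylinder,
          Measure.volume_eq_prod, setLIntegral_prod _ hmeas.restrict]
    _ ≤ ENNReal.ofReal (C * (ε ^ d)⁻¹) * ENNReal.ofReal (A * (2 * ε) ^ (d + 2)) := by gcongr
    _ = ENNReal.ofReal (C * A * 2 ^ (d + 2) * ε * ε) := by
        rw [← ENNReal.ofReal_mul (by positivity)]
        congr 1
        field_simp
        ring
    _ < ENNReal.ofReal (ε / 2) := by
        rw [ENNReal.ofReal_lt_ofReal_iff (half_pos hε)]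
        nlinarith

/-! ### Comparison of skewed and parabolic cylinders -/

theorem isQLebesguePoint_of_tendsto {d : ℕ} {φ : Rd d → ℝ} {S T : EReal} {u : ℝ → Rd d → Rd d}
    {f : ℝ × Rd d → ℝ} (hf : LocallyIntegrable f volume) {z : ℝ × Rd d}
    (hflow : ∀ᶠ ε in 𝓝[>] (0 : ℝ), ∀ s, |s - z.1| < ε ^ 2 →
      ‖mollifiedFlow φ S T u ε z.1 z.2 s - z.2‖ < ε / 2)
    (hz : Tendsto (fun r : ℝ => ⨍ w in parabolicCylinder z r, ‖f w - f z‖) (𝓝[>] 0) (𝓝 0)) :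
    IsQLebesguePoint φ S T u f z.1 z.2 := by
  have htwo : Tendsto (fun ε : ℝ => 2 * ε) (𝓝[>] 0) (𝓝[>] 0) :=
    fun _ h => eventually_nhdsGT_zero_mul_left two_pos h
  have hlim := (hz.comp htwo).const_mul ((8 : ℝ) ^ (d + 2))
  rw [mul_zero] at hlim
  refine squeeze_zero' (Eventually.of_forall fun ε => ?_) ?_ hlim
  · rw [setAverage_eq]
    exact smul_nonneg (by positivity) (integral_nonneg fun _ => abs_nonneg _)
  filter_upwards [self_mem_nhdsWithin, hflow] with ε (hε : 0 < ε) hX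
  -- In space, `ε / 4 + ε / 2 < ε`.
  have hinner : parabolicCylinder z (ε / 4) ⊆ skewedCylinder φ S T u ε z.1 z.2 := by
    rintro ⟨s, y⟩ ⟨hs, hy⟩
    rw [Metric.mem_closedBall, Real.dist_eq] at hs
    rw [mem_closedBall_iff_norm] at hy
    have hs' : |s - z.1| < ε ^ 2 := by
      have : 0 < ε ^ 2 := by positivity
      simp only at hs
      nlinarith
    refine ⟨hs', ?_⟩
    have hXs := hX s hs'
    rw [norm_sub_rev] at hXs
    have := norm_sub_le_norm_sub_add_norm_sub y z.2 (mollifiedFlow φ S T u ε z.1 z.2 s)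
    simp only at hy ⊢
    linarith
  -- In space, `ε + ε / 2 < 2 * ε`.
  have houter : skewedCylinder φ S T u ε z.1 z.2 ⊆ parabolicCylinder z (2 * ε) := by
    rintro ⟨s, y⟩ ⟨hs, hy⟩
    have hXs := hX s hs
    have := norm_sub_le_norm_sub_add_norm_sub y (mollifiedFlow φ S T u ε z.1 z.2 s) z.2
    simp only at hs hy
    refine ⟨?_, ?_⟩
    · rw [Metric.mem_closedBall, Real.dist_eq]
      simp only
      nlinarith
    · rw [mem_closedBall_iff_norm]
      simp only
      linarith
  set κ := (2 * volume (Metric.ball (0 : Rd d) 1)).toReal with hκ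
  have hκ0 : 0 < κ :=
    ENNReal.toReal_pos (two_mul_volume_ball_ne_zero d) (two_mul_volume_ball_ne_top d)
  have hvol : ∀ r : ℝ, 0 < r → volume.real (parabolicCylinder z r) = r ^ (d + 2) * κ := by
    intro r hr
    rw [measureReal_def, volume_parabolicCylinder z hr.le, ENNReal.toReal_mul,
      ENNReal.toReal_ofReal (by positivity)]
  have hfin := (isCompact_parabolicCylinder z (2 * ε)).measure_lt_top (μ := volume)
  have hlow : (ε / 4) ^ (d + 2) * κ ≤ volume.real (skewedCylinder φ S T u ε z.1 z.2) := by
    rw [← hvol _ (by positivity)]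
    exact measureReal_mono hinner (measure_ne_top_of_subset houter hfin.ne)
  have hint : IntegrableOn (fun w => |f w - f z|) (parabolicCylinder z (2 * ε)) :=
    ((hf.integrableOn_isCompact (isCompact_parabolicCylinder z (2 * ε))).sub
      (integrableOn_const hfin.ne)).abs
  have hpos : 0 < (ε / 4) ^ (d + 2) * κ := by positivity
  simp only [Function.comp_apply, Real.norm_eq_abs]
  rw [setAverage_eq, setAverage_eq, hvol _ (by positivity), smul_eq_mul, smul_eq_mul]
  -- The volume is bounded below by the inner cylinder and the integral above by the outer one. Only
  -- the inclusions enter, so measurability of the skewed cylinder is not needed.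
  calc _ ≤ ((ε / 4) ^ (d + 2) * κ)⁻¹ * ∫ w in parabolicCylinder z (2 * ε), |f w - f z| := by
        refine mul_le_mul (inv_anti₀ hpos hlow) (setIntegral_mono_set hint
          (Eventually.of_forall fun _ => abs_nonneg _) houter.eventuallyLE)
          (integral_nonneg fun _ => abs_nonneg _) (by positivity)
    _ = _ := by
        rw [show 2 * ε = 8 * (ε / 4) by ring, mul_pow]
        field_simp

end SkewedCylinder

theorem mainTheorem8 (d : ℕ) (hd : 1 ≤ d)
    (φ : SkewedCylinder.Rd d → ℝ) (hφ : SkewedCylinder.IsMollifier φ)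
    (S T : EReal) (hST : S < T)
    (p q : ℝ≥0∞) (hp : 1 ≤ p) (hq : 1 ≤ q)
    (u : ℝ → SkewedCylinder.Rd d → SkewedCylinder.Rd d)
    (G : ℝ → SkewedCylinder.Rd d → (SkewedCylinder.Rd d →L[ℝ] SkewedCylinder.Rd d))
    (hu : SkewedCylinder.MemL1LocHomSobolev S T p u G)
    (hdiv : ∀ᵐ t ∂(volume.restrict (SkewedCylinder.timeInterval S T)),
      SkewedCylinder.IsWeaklyDivFree (u t))
    (hM : MemLp (fun z : ℝ × SkewedCylinder.Rd d =>
        SkewedCylinder.maximalFunction (G z.1) z.2) q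
      (volume.restrict (SkewedCylinder.slab d S T)))
    (f : ℝ × SkewedCylinder.Rd d → ℝ) (hf : Integrable f volume) :
    ∀ᵐ z : ℝ × SkewedCylinder.Rd d ∂volume,
      SkewedCylinder.IsQLebesguePoint φ S T u f z.1 z.2 := by
  filter_upwards [SkewedCylinder.ae_eventually_norm_mollifiedFlow_sub_lt hφ hu.locallyIntegrableOn,
    SkewedCylinder.ae_tendsto_average_parabolicCylinder hf.locallyIntegrable] with z hflow hz
  exact SkewedCylinder.isQLebesguePoint_of_tendsto hf.locallyIntegrable hflow hz
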